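/- Throughout, a monoid is a commutative monoid $M$ with an absorbing element $0_M$. Its prime spectrum $\operatorname{Spec} M$ (prime ideals, Zariski topology, structure sheaf of locally fractional families) is an affine monoid scheme, and a monoid scheme is a topological space with a sheaf of monoids that is locally isomorphic to affine monoid schemes. A monoid $M$ is cancellative if $ab=ac$ with $a\neq 0_M$ implies $b=c$. An idempotent semifield is a commutative semiring $K$ with $0\ne 1$ in which every nonzero element is invertible and $a+a=a$ for all $a$. The scalar extension $X_K=X\times_{\operatorname{Spec}\mathbb F_1}\operatorname{Spec}K$ of a monoid scheme $X$ is the semiring scheme obtained by gluing the affine semiring schemes $\operatorname{Spec}K[M]$ over the affine open subschemes $\operatorname{Spec}M$ of $X$, where $K[M]$ is the monoid semiring in which $0_M$ is identified with $0$; for $U\subseteq X$ open, $U_K=U\times_{\operatorname{Spec}\mathbb F_1}\operatorname{Spec}K$ is the open subset of $X_K$ lying over $U$. **Theorem.** Let $X$ be an irreducible monoid scheme and let $\mathcal U=\{U_\alpha\}$ be an affine open cover of $X$ such that every intersection of finitely many (at least one) of the sets $U_\alpha$ is isomorphic to the prime spectrum of a cancellative monoid. Let $K$ be an idempotent semifield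 and let $\mathcal U_K=\{(U_\alpha)_K\}$ be the induced open cover of $X_K$. Then there is an isomorphism of Čech cohomology groups $$\mathrm H^1(\mathcal U_K,\mathcal O_{X_K}^\times)\;\cong\;\mathrm H^1(\mathcal U,\mathcal K^\times\times\mathcal O_X^\times),$$ where $\mathcal O_X^\times$ and $\mathcal O_{X_K}^\times$ are the sheaves of units and $\mathcal K^\times$ is the constant sheaf on $X$ associated with the abelian group $K^\times$. -/

import Mathlib

open TopologicalSpace

universe u v w

noncomputable section

namespace MonSch

/-! ## Monoid schemes

A monoid is a commutative monoid with an absorbing element (`CommMonoidWithZero`; the monoid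
`{0 = 1}` is allowed).  Morphisms preserve `1`, the product and the absorbing element. -/

/-- A monoidal space: a topological space with a sheaf of monoids (with absorbing element). -/
structure MonoidalSpace where
  /-- The underlying set of points. -/
  carrier : Type u
  [top : TopologicalSpace carrier]
  /-- The sections over an open set. -/
  obj : Opens carrier → Type u
  [mon : ∀ U, CommMonoidWithZero (obj U)]
  /-- The restriction maps. -/
  res : ∀ {U V : Opens carrier}, V ≤ U → obj U →*₀ obj V
  res_self : ∀ {U : Opens carrier} (s : obj U), res (le_refl U) s = s
  res_res : ∀ {U V W : Opens carrier} (h : V ≤ U) (h' : W ≤ V) (s : obj U),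
    res h' (res h s) = res (h'.trans h) s
  /-- The sheaf condition: a compatible family on a cover of `W` glues in exactly one way. -/
  sheaf : ∀ {ι : Type u} (W : Opens carrier) (U : ι → Opens carrier) (hU : ∀ i, U i ≤ W),
    W ≤ ⨆ i, U i → ∀ s : ∀ i, obj (U i),
    (∀ i j, res (inf_le_left : U i ⊓ U j ≤ U i) (s i) =
      res (inf_le_right : U i ⊓ U j ≤ U j) (s j)) →
    ∃! t : obj W, ∀ i, res (hU i) t = s i

attribute [instance] MonoidalSpace.top MonoidalSpace.mon

/-- The image in `X` of an open subset of an open subspace. -/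
def openImage {X : Type u} [TopologicalSpace X] (U : Opens X) (V : Opens U) : Opens X :=
  ⟨Subtype.val '' (V : Set U), U.isOpen.isOpenMap_subtype_val _ V.isOpen⟩

theorem openImage_mono {X : Type u} [TopologicalSpace X] (U : Opens X) {V W : Opens U}
    (h : V ≤ W) : openImage U V ≤ openImage U W :=
  Set.image_mono h

/-- The open subspace `U` of a monoidal space, with the restricted sheaf. -/
def MonoidalSpace.restrict (X : MonoidalSpace.{u}) (U : Opens X.carrier) :
    MonoidalSpace.{u} where
  carrier := U
  obj V := X.obj (openImage U V)
  res h := X.res (openImage_mono U h)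
  res_self s := X.res_self s
  res_res _ _ s := X.res_res _ _ s
  sheaf := by
    intro ι W V hV hW s hs
    refine X.sheaf (openImage U W) (fun i => openImage U (V i))
      (fun i => openImage_mono U (hV i)) ?_ s ?_
    · rintro _ ⟨y, hy, rfl⟩
      obtain ⟨i, hi⟩ := Opens.mem_iSup.1 (hW hy)
      exact Opens.mem_iSup.2 ⟨i, y, hi, rfl⟩
    · intro i j
      have hle : openImage U (V i) ⊓ openImage U (V j) ≤ openImage U (V i ⊓ V j) := by
        rintro _ ⟨⟨y, hy, rfl⟩, ⟨z, hz, hzy⟩⟩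
        obtain rfl := Subtype.ext hzy
        exact ⟨z, ⟨hy, hz⟩, rfl⟩
      have h := congrArg (X.res hle) (hs i j)
      rw [X.res_res, X.res_res] at h
      exact h

/-- An isomorphism of monoidal spaces: a homeomorphism with an isomorphism of sheaves over it.
(It induces isomorphisms on stalks, so it is automatically local.) -/
structure MonoidalSpace.Iso (X Y : MonoidalSpace.{u}) where
  /-- The map on points. -/
  homeo : X.carrier ≃ₜ Y.carrier
  /-- The map on sections. -/
  sec : ∀ V : Opens Y.carrier,
    Y.obj V ≃* X.obj (Opens.comap (homeo : C(X.carrier, Y.carrier)) V)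
  sec_res : ∀ {V W : Opens Y.carrier} (h : W ≤ V) (s : Y.obj V),
    sec W (Y.res h s) = X.res (Opens.comap_mono _ h) (sec V s)

/-! ### The prime spectrum of a monoid -/

/-- A prime ideal of the monoid `M`: a proper ideal whose complement is multiplicative. -/
structure PrimeIdeal (M : Type u) [CommMonoidWithZero M] where
  /-- The underlying set. -/
  carrier : Set M
  zero_mem : (0 : M) ∈ carrier
  mul_mem : ∀ (a : M) {b : M}, b ∈ carrier → a * b ∈ carrier
  one_notMem : (1 : M) ∉ carrier
  mem_or_mem : ∀ {a b : M}, a * b ∈ carrier → a ∈ carrier ∨ b ∈ carrier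

/-- The complement of a prime ideal. -/
def PrimeIdeal.compl {M : Type u} [CommMonoidWithZero M] (p : PrimeIdeal M) : Submonoid M where
  carrier := p.carrierᶜ
  one_mem' := p.one_notMem
  mul_mem' ha hb h := (p.mem_or_mem h).elim ha hb

/-- The Zariski topology, generated by the sets `D(f)`. -/
instance (M : Type u) [CommMonoidWithZero M] : TopologicalSpace (PrimeIdeal M) :=
  generateFrom {S | ∃ f : M, S = {p | f ∉ p.carrier}}

/-- Families of elements of the localizations `M_p`, `p ∈ V`, that are locally given by a
fraction `a / f` of elements of `M`. -/
def IsLocallyFraction {M : Type u} [CommMonoidWithZero M] (V : Opens (PrimeIdeal M))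
    (s : ∀ p : V, Localization p.1.compl) : Prop :=
  ∀ p : V, ∃ (W : Opens (PrimeIdeal M)) (_ : p.1 ∈ W) (hWV : W ≤ V) (a f : M),
    ∀ (q : PrimeIdeal M) (hq : q ∈ W), ∃ hf : f ∈ q.compl,
      s ⟨q, hWV hq⟩ = Localization.mk a ⟨f, hf⟩

/-- Sections of the structure sheaf of `Spec M`. -/
def SpecSections (M : Type u) [CommMonoidWithZero M] (V : Opens (PrimeIdeal M)) :
    Submonoid (∀ p : V, Localization p.1.compl) where
  carrier := {s | IsLocallyFraction V s}
  one_mem' p := ⟨V, p.2, le_rfl, 1, 1, fun q _ => ⟨q.compl.one_mem, Localization.mk_one.symm⟩⟩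
  mul_mem' := by
    intro s t hs ht p
    obtain ⟨W, hpW, hWV, a, f, h⟩ := hs p
    obtain ⟨W', hpW', hWV', a', f', h'⟩ := ht p
    refine ⟨W ⊓ W', ⟨hpW, hpW'⟩, inf_le_left.trans hWV, a * a', f * f', fun q hq => ?_⟩
    obtain ⟨hf, e⟩ := h q hq.1
    obtain ⟨hf', e'⟩ := h' q hq.2
    refine ⟨q.compl.mul_mem hf hf', ?_⟩
    rw [Pi.mul_apply, e, e', Localization.mk_mul]
    rfl

theorem isLocallyFraction_zero {M : Type u} [CommMonoidWithZero M] (V : Opens (PrimeIdeal M)) :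
    IsLocallyFraction V 0 :=
  fun p => ⟨V, p.2, le_rfl, 0, 1, fun q _ => ⟨q.compl.one_mem, (Localization.mk_zero _).symm⟩⟩

instance (M : Type u) [CommMonoidWithZero M] (V : Opens (PrimeIdeal M)) :
    CommMonoidWithZero (SpecSections M V) where
  zero := ⟨0, isLocallyFraction_zero V⟩
  zero_mul a := Subtype.ext (zero_mul a.1)
  mul_zero a := Subtype.ext (mul_zero a.1)

/-- The affine monoid scheme `Spec M`. -/
def Spec (M : Type u) [CommMonoidWithZero M] : MonoidalSpace.{u} where
  carrier := PrimeIdeal M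
  obj V := SpecSections M V
  res {U V} h :=
    { toFun := fun s => ⟨fun p => s.1 ⟨p.1, h p.2⟩, fun p => by
        obtain ⟨W, hpW, hWU, a, f, e⟩ := s.2 ⟨p.1, h p.2⟩
        exact ⟨W ⊓ V, ⟨hpW, p.2⟩, inf_le_right, a, f, fun q hq => e q hq.1⟩⟩
      map_zero' := rfl
      map_one' := rfl
      map_mul' := fun _ _ => rfl }
  res_self _ := rfl
  res_res _ _ _ := rfl
  sheaf := by
    intro ι W U hU hW s hs
    have hex : ∀ p : W, ∃ i, p.1 ∈ U i := fun p => Opens.mem_iSup.1 (hW p.2)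
    choose i hi using hex
    have key : ∀ (p : PrimeIdeal M) (j k : ι) (hj : p ∈ U j) (hk : p ∈ U k),
        (s j).1 ⟨p, hj⟩ = (s k).1 ⟨p, hk⟩ := fun p j k hj hk =>
      congrFun (congrArg Subtype.val (hs j k)) ⟨p, hj, hk⟩
    refine ⟨⟨fun p => (s (i p)).1 ⟨p.1, hi p⟩, fun p => ?_⟩, ?_, ?_⟩
    · obtain ⟨V, hpV, hVU, a, f, e⟩ := (s (i p)).2 ⟨p.1, hi p⟩
      refine ⟨V, hpV, hVU.trans (hU _), a, f, fun q hq => ?_⟩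
      obtain ⟨hf, e'⟩ := e q hq
      exact ⟨hf, (key q _ _ (hi ⟨q, hU _ (hVU hq)⟩) (hVU hq)).trans e'⟩
    · intro j
      exact Subtype.ext (funext fun p => key p.1 _ _ _ p.2)
    · intro t ht
      exact Subtype.ext (funext fun p =>
        congrFun (congrArg Subtype.val (ht (i p))) ⟨p.1, hi p⟩)

/-- A monoid scheme: a monoidal space that is locally isomorphic to affine monoid schemes. -/
structure MonoidScheme extends MonoidalSpace.{u} where
  locally_affine : ∀ x : carrier, ∃ (U : Opens carrier) (_ : x ∈ U) (M : Type u)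
    (_ : CommMonoidWithZero M), Nonempty ((toMonoidalSpace.restrict U).Iso (Spec M))

/-- A cancellative monoid: `a b = a c` and `a ≠ 0` imply `b = c`. -/
def IsCancellative (M : Type u) [CommMonoidWithZero M] : Prop :=
  ∀ a b c : M, a ≠ 0 → a * b = a * c → b = c

/-- A cover by open sets such that every intersection of finitely many (at least one) of them is
isomorphic to the prime spectrum of a cancellative monoid; in particular its members are
affine. -/
structure MonoidScheme.IsCancellativeCover (X : MonoidScheme.{u}) {ι : Type w}
    (U : ι → Opens X.carrier) : Prop where
  covers : ⨆ i, U i = ⊤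
  inter : ∀ s : Finset ι, s.Nonempty → ∃ (M : Type u) (_ : CommMonoidWithZero M),
    IsCancellative M ∧ Nonempty ((X.restrict (s.inf U)).Iso (Spec M))

/-! ### Stalks -/

namespace MonoidalSpace

variable (X : MonoidalSpace.{u}) (x : X.carrier)

/-- Restriction of sections between open neighbourhoods of `x`, ordered by reverse inclusion. -/
def nhdsRes (i j : (OpenNhdsOf x)ᵒᵈ) (h : i ≤ j) :
    X.obj (OrderDual.ofDual i).toOpens →*₀ X.obj (OrderDual.ofDual j).toOpens :=
  X.res (show (OrderDual.ofDual j).toOpens ≤ (OrderDual.ofDual i).toOpens from h)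

instance : DirectedSystem (fun i : (OpenNhdsOf x)ᵒᵈ => X.obj (OrderDual.ofDual i).toOpens)
    (fun i j h => X.nhdsRes x i j h) where
  map_self _ s := X.res_self s
  map_map _ _ _ _ _ s := X.res_res _ _ s

/-- The stalk of the structure sheaf at `x`. -/
def Stalk : Type u :=
  DirectLimit (fun i : (OpenNhdsOf x)ᵒᵈ => X.obj (OrderDual.ofDual i).toOpens) (X.nhdsRes x)

instance : CommMonoidWithZero (X.Stalk x) :=
  { (inferInstance : CommMonoid (DirectLimit
      (fun i : (OpenNhdsOf x)ᵒᵈ => X.obj (OrderDual.ofDual i).toOpens) (X.nhdsRes x))),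
    (inferInstance : MonoidWithZero (DirectLimit
      (fun i : (OpenNhdsOf x)ᵒᵈ => X.obj (OrderDual.ofDual i).toOpens) (X.nhdsRes x))) with }

variable {x}

/-- The germ at `x` of a section over an open neighbourhood of `x`. -/
def germ (U : Opens X.carrier) (hx : x ∈ U) : X.obj U →*₀ X.Stalk x where
  toFun s := Quotient.mk (DirectLimit.setoid (X.nhdsRes x)) ⟨OrderDual.toDual ⟨U, hx⟩, s⟩
  map_zero' := (DirectLimit.zero_def (f := X.nhdsRes x) (OrderDual.toDual ⟨U, hx⟩)).symm
  map_one' := (DirectLimit.one_def (f := X.nhdsRes x) (OrderDual.toDual ⟨U, hx⟩)).symm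
  map_mul' s t :=
    (DirectLimit.mul_def (f := X.nhdsRes x) (OrderDual.toDual ⟨U, hx⟩) s t).symm

theorem germ_res {U V : Opens X.carrier} (h : V ≤ U) (hx : x ∈ V) :
    (X.germ V hx).comp (X.res h) = X.germ U (h hx) := by
  ext s
  exact DirectLimit.mk_apply (f := X.nhdsRes x) (OrderDual.toDual ⟨U, h hx⟩)
    (OrderDual.toDual ⟨V, hx⟩) s h

end MonoidalSpace

/-! ## Scalar extension -/

/-- The congruence on the monoid semiring that identifies the absorbing element of `M` with the
zero of the semiring. -/
def zeroCon (K : Type v) (M : Type u) [CommSemiring K] [CommMonoidWithZero M] :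
    RingCon (MonoidAlgebra K M) :=
  ringConGen fun a b => a = MonoidAlgebra.single 0 1 ∧ b = 0

/-- The monoid semiring `K[M]` of a monoid with absorbing element: finite formal sums of terms
`a m` with `a ∈ K`, `m ∈ M`, where `0_M` is identified with `0`. -/
def MonSemiring (K : Type v) (M : Type u) [CommSemiring K] [CommMonoidWithZero M] :
    Type max u v :=
  (zeroCon K M).Quotient

section MonSemiring

variable (K : Type v) [CommSemiring K]

instance (M : Type u) [CommMonoidWithZero M] : CommSemiring (MonSemiring K M) :=
  inferInstanceAs (CommSemiring (zeroCon K M).Quotient)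

/-- The monomial `1 m` of `K[M]`. -/
def MonSemiring.of {M : Type u} [CommMonoidWithZero M] (m : M) : MonSemiring K M :=
  (zeroCon K M).mk' (MonoidAlgebra.single m 1)

/-- The homomorphism `K[M] → K[N]` induced by a homomorphism `M → N`. -/
def MonSemiring.map {M N : Type u} [CommMonoidWithZero M] [CommMonoidWithZero N]
    (φ : M →*₀ N) : MonSemiring K M →+* MonSemiring K N :=
  (zeroCon K M).lift
    ((zeroCon K N).mk'.comp (MonoidAlgebra.mapDomainRingHom K (φ : M →* N))) <| by
    refine RingCon.ringConGen_le.2 ?_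
    rintro _ _ ⟨rfl, rfl⟩
    have h : (zeroCon K N) (MonoidAlgebra.single 0 1) 0 :=
      RingConGen.Rel.of _ _ ⟨rfl, rfl⟩
    have h' := (RingCon.eq (zeroCon K N)).2 h
    change (zeroCon K N).mk' (MonoidAlgebra.mapDomain φ (MonoidAlgebra.single 0 1)) =
      (zeroCon K N).mk' (MonoidAlgebra.mapDomain φ 0)
    rw [MonoidAlgebra.mapDomain_single, MonoidAlgebra.mapDomain_zero, map_zero]
    exact h'

theorem MonSemiring.map_map {M N P : Type u} [CommMonoidWithZero M] [CommMonoidWithZero N]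
    [CommMonoidWithZero P] (φ : M →*₀ N) (ψ : N →*₀ P) (a : MonSemiring K M) :
    MonSemiring.map K ψ (MonSemiring.map K φ a) = MonSemiring.map K (ψ.comp φ) a := by
  induction a using Quotient.inductionOn with | _ a => ?_
  change (zeroCon K P).mk' (MonoidAlgebra.mapDomainRingHom K (ψ : N →* P)
      (MonoidAlgebra.mapDomainRingHom K (φ : M →* N) a)) =
    (zeroCon K P).mk' (MonoidAlgebra.mapDomainRingHom K ((ψ.comp φ : M →*₀ P) : M →* P) a)
  congr 1
  change MonoidAlgebra.mapDomain ψ (MonoidAlgebra.mapDomain φ a) =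
    MonoidAlgebra.mapDomain (ψ ∘ φ) a
  induction a using MonoidAlgebra.induction_linear with
  | zero => simp
  | add a b ha hb => simp only [MonoidAlgebra.mapDomain_add, ha, hb]
  | single m k => simp

end MonSemiring

/-- A semiringed space: a topological space with a sheaf of commutative semirings. -/
structure SemiringedSpace where
  /-- The underlying set of points. -/
  carrier : Type u
  [top : TopologicalSpace carrier]
  /-- The sections over an open set. -/
  obj : Opens carrier → Type u
  [semi : ∀ U, CommSemiring (obj U)]
  /-- The restriction maps. -/
  res : ∀ {U V : Opens carrier}, V ≤ U → obj U →+* obj V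
  res_self : ∀ {U : Opens carrier} (s : obj U), res (le_refl U) s = s
  res_res : ∀ {U V W : Opens carrier} (h : V ≤ U) (h' : W ≤ V) (s : obj U),
    res h' (res h s) = res (h'.trans h) s
  /-- The sheaf condition: a compatible family on a cover of `W` glues in exactly one way. -/
  sheaf : ∀ {ι : Type u} (W : Opens carrier) (U : ι → Opens carrier) (hU : ∀ i, U i ≤ W),
    W ≤ ⨆ i, U i → ∀ s : ∀ i, obj (U i),
    (∀ i j, res (inf_le_left : U i ⊓ U j ≤ U i) (s i) =
      res (inf_le_right : U i ⊓ U j ≤ U j) (s j)) →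
    ∃! t : obj W, ∀ i, res (hU i) t = s i

attribute [instance] SemiringedSpace.top SemiringedSpace.semi

namespace MonoidalSpace

variable (X : MonoidalSpace.{u}) (K : Type v) [CommSemiring K]

/-- The points of the scalar extension `X_K`.  A prime of `K[M]` is the same as a prime `p` of
`M` (its contraction) together with a prime of `K[M_p]` that contracts to the maximal ideal of
`M_p`; thus a point of `X_K` is a point `x` of `X` with a prime ideal of `K[O_{X,x}]` that
contracts to the maximal ideal of `O_{X,x}`, i.e. to the set of non-units. -/
structure ExtPoint where
  /-- The image in `X`. -/
  base : X.carrier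
  /-- The prime ideal of `K[O_{X,x}]`. -/
  prime : PrimeSpectrum (MonSemiring K (X.Stalk base))
  contracts : ∀ a : X.Stalk base, MonSemiring.of K a ∈ prime.asIdeal ↔ ¬ IsUnit a

/-- The map `K[O_X(U)] → K[O_{X,x}]` induced by taking germs at `x ∈ U`. -/
def extGerm {x : X.carrier} (U : Opens X.carrier) (hx : x ∈ U) :
    MonSemiring K (X.obj U) →+* MonSemiring K (X.Stalk x) :=
  MonSemiring.map K (X.germ U hx)

/-- The restriction map `K[O_X(U)] → K[O_X(V)]`. -/
def extRes {U V : Opens X.carrier} (h : V ≤ U) :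
    MonSemiring K (X.obj U) →+* MonSemiring K (X.obj V) :=
  MonSemiring.map K (X.res h)

theorem extGerm_extRes {x : X.carrier} {U V : Opens X.carrier} (h : V ≤ U) (hx : x ∈ V)
    (a : MonSemiring K (X.obj U)) :
    X.extGerm K V hx (X.extRes K h a) = X.extGerm K U (h hx) a := by
  rw [extGerm, extRes, MonSemiring.map_map, germ_res, extGerm]

variable {K} in
/-- The complement of the prime ideal of `K[O_{X,x}]` at a point of `X_K`. -/
abbrev ExtPoint.compl {X : MonoidalSpace.{u}} (z : X.ExtPoint K) :
    Submonoid (MonSemiring K (X.Stalk z.base)) :=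
  z.prime.asIdeal.primeCompl

/-- The Zariski topology of `X_K`, generated by the sets `D(f) ⊆ Spec K[O_X(U)]`, where
`U ⊆ X` is open and `f ∈ K[O_X(U)]`. -/
instance : TopologicalSpace (X.ExtPoint K) :=
  generateFrom {S | ∃ (U : Opens X.carrier) (f : MonSemiring K (X.obj U)),
    S = {z | ∃ h : z.base ∈ U, X.extGerm K U h f ∈ z.compl}}

/-- The projection `X_K → X`. -/
def extProj : C(X.ExtPoint K, X.carrier) where
  toFun := ExtPoint.base
  continuous_toFun := by
    refine ⟨fun U hU => ?_⟩
    refine isOpen_generateFrom_of_mem ⟨⟨U, hU⟩, 1, ?_⟩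
    ext z
    constructor
    · intro h
      exact ⟨h, by rw [map_one]; exact z.compl.one_mem⟩
    · rintro ⟨h, -⟩
      exact h

/-- The open subset `U_K = U ×_{Spec F_1} Spec K` of `X_K`: the points over `U`. -/
def extOpen (U : Opens X.carrier) : Opens (X.ExtPoint K) :=
  Opens.comap (X.extProj K) U

/-- Families of elements of the local semirings `K[O_{X,x}]_q`, indexed by the points `(x, q)` of
`V ⊆ X_K`, that are locally given by a fraction `a / f` with `a, f ∈ K[O_X(U)]`, `U ⊆ X` open. -/
def IsLocallyExtFraction (V : Opens (X.ExtPoint K))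
    (s : ∀ z : V, Localization z.1.compl) : Prop :=
  ∀ z : V, ∃ (U : Opens X.carrier) (W : Opens (X.ExtPoint K)) (_ : z.1 ∈ W) (hWV : W ≤ V)
    (hWU : ∀ y ∈ W, y.base ∈ U) (a f : MonSemiring K (X.obj U)),
    ∀ (y : X.ExtPoint K) (hy : y ∈ W), ∃ hf : X.extGerm K U (hWU y hy) f ∈ y.compl,
      s ⟨y, hWV hy⟩ = Localization.mk (X.extGerm K U (hWU y hy) a) ⟨_, hf⟩

variable {X K} in
theorem IsLocallyExtFraction.common {V : Opens (X.ExtPoint K)}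
    {s t : ∀ z : V, Localization z.1.compl} (hs : X.IsLocallyExtFraction K V s)
    (ht : X.IsLocallyExtFraction K V t) (z : V) :
    ∃ (U : Opens X.carrier) (W : Opens (X.ExtPoint K)) (_ : z.1 ∈ W) (hWV : W ≤ V)
    (hWU : ∀ y ∈ W, y.base ∈ U) (a f b g : MonSemiring K (X.obj U)),
    ∀ (y : X.ExtPoint K) (hy : y ∈ W), ∃ (hf : X.extGerm K U (hWU y hy) f ∈ y.compl)
      (hg : X.extGerm K U (hWU y hy) g ∈ y.compl),
      s ⟨y, hWV hy⟩ = Localization.mk (X.extGerm K U (hWU y hy) a) ⟨_, hf⟩ ∧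
      t ⟨y, hWV hy⟩ = Localization.mk (X.extGerm K U (hWU y hy) b) ⟨_, hg⟩ := by
  obtain ⟨U, W, hz, hWV, hWU, a, f, h⟩ := hs z
  obtain ⟨U', W', hz', hWV', hWU', b, g, h'⟩ := ht z
  refine ⟨U ⊓ U', W ⊓ W', ⟨hz, hz'⟩, inf_le_left.trans hWV,
    fun y hy => ⟨hWU y hy.1, hWU' y hy.2⟩, X.extRes K inf_le_left a, X.extRes K inf_le_left f,
    X.extRes K inf_le_right b, X.extRes K inf_le_right g, fun y hy => ?_⟩
  obtain ⟨hf, e⟩ := h y hy.1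
  obtain ⟨hg, e'⟩ := h' y hy.2
  have hy' : y.base ∈ U ⊓ U' := ⟨hWU y hy.1, hWU' y hy.2⟩
  have ea := X.extGerm_extRes K inf_le_left hy' a
  have ef := X.extGerm_extRes K inf_le_left hy' f
  have eb := X.extGerm_extRes K inf_le_right hy' b
  have eg := X.extGerm_extRes K inf_le_right hy' g
  refine ⟨ef.symm ▸ hf, eg.symm ▸ hg, e.trans ?_, e'.trans ?_⟩
  · exact congrArg₂ Localization.mk ea.symm (Subtype.ext ef.symm)
  · exact congrArg₂ Localization.mk eb.symm (Subtype.ext eg.symm)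

/-- Sections of the structure sheaf of `X_K`. -/
def ExtSections (V : Opens (X.ExtPoint K)) :
    Subsemiring (∀ z : V, Localization z.1.compl) where
  carrier := {s | X.IsLocallyExtFraction K V s}
  one_mem' z := ⟨⊤, V, z.2, le_rfl, fun _ _ => trivial, 1, 1, fun y _ =>
    ⟨by rw [map_one]; exact y.compl.one_mem, by
      simp only [map_one]; exact Localization.mk_one.symm⟩⟩
  zero_mem' z := ⟨⊤, V, z.2, le_rfl, fun _ _ => trivial, 0, 1, fun y _ =>
    ⟨by rw [map_one]; exact y.compl.one_mem, by
      rw [map_zero]; exact (Localization.mk_zero _).symm⟩⟩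
  mul_mem' := by
    intro s t hs ht z
    obtain ⟨U, W, hz, hWV, hWU, a, f, b, g, h⟩ := IsLocallyExtFraction.common hs ht z
    refine ⟨U, W, hz, hWV, hWU, a * b, f * g, fun y hy => ?_⟩
    obtain ⟨hf, hg, e, e'⟩ := h y hy
    refine ⟨by rw [map_mul]; exact y.compl.mul_mem hf hg, ?_⟩
    simp only [map_mul]
    rw [Pi.mul_apply, e, e', Localization.mk_mul]
    rfl
  add_mem' := by
    intro s t hs ht z
    obtain ⟨U, W, hz, hWV, hWU, a, f, b, g, h⟩ := IsLocallyExtFraction.common hs ht z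
    refine ⟨U, W, hz, hWV, hWU, f * b + g * a, f * g, fun y hy => ?_⟩
    obtain ⟨hf, hg, e, e'⟩ := h y hy
    refine ⟨by rw [map_mul]; exact y.compl.mul_mem hf hg, ?_⟩
    simp only [map_mul, map_add]
    rw [Pi.add_apply, e, e', Localization.add_mk]
    rfl

/-- The scalar extension `X_K = X ×_{Spec F_1} Spec K`, described intrinsically.  Over an affine
open `Spec M` of `X` it is `Spec K[M]` with its usual structure sheaf of locally fractional
families: the points and the topology are those of `Spec K[M]`, and the local semiring
`K[O_{X,x}]_q` at the point `(x, q)` is the localization of `K[M]` at the corresponding prime. -/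
def scalarExt : SemiringedSpace.{max u v} where
  carrier := X.ExtPoint K
  obj V := X.ExtSections K V
  res {U V} h :=
    { toFun := fun s => ⟨fun z => s.1 ⟨z.1, h z.2⟩, fun z => by
        obtain ⟨U', W, hz, hWU, hWU', a, f, e⟩ := s.2 ⟨z.1, h z.2⟩
        exact ⟨U', W ⊓ V, ⟨hz, z.2⟩, inf_le_right, fun y hy => hWU' y hy.1, a, f,
          fun q hq => e q hq.1⟩⟩
      map_zero' := rfl
      map_one' := rfl
      map_add' := fun _ _ => rfl
      map_mul' := fun _ _ => rfl }
  res_self _ := rfl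
  res_res _ _ _ := rfl
  sheaf := by
    intro ι W U hU hW s hs
    have hex : ∀ p : W, ∃ i, p.1 ∈ U i := fun p => Opens.mem_iSup.1 (hW p.2)
    choose i hi using hex
    have key : ∀ (p : X.ExtPoint K) (j k : ι) (hj : p ∈ U j) (hk : p ∈ U k),
        (s j).1 ⟨p, hj⟩ = (s k).1 ⟨p, hk⟩ := fun p j k hj hk =>
      congrFun (congrArg Subtype.val (hs j k)) ⟨p, hj, hk⟩
    refine ⟨⟨fun p => (s (i p)).1 ⟨p.1, hi p⟩, fun p => ?_⟩, ?_, ?_⟩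
    · obtain ⟨U', V, hpV, hVU, hVU', a, f, e⟩ := (s (i p)).2 ⟨p.1, hi p⟩
      refine ⟨U', V, hpV, hVU.trans (hU _), hVU', a, f, fun q hq => ?_⟩
      obtain ⟨hf, e'⟩ := e q hq
      exact ⟨hf, (key q _ _ (hi ⟨q, hU _ (hVU hq)⟩) (hVU hq)).trans e'⟩
    · intro j
      exact Subtype.ext (funext fun p => key p.1 _ _ _ p.2)
    · intro t ht
      exact Subtype.ext (funext fun p =>
        congrFun (congrArg Subtype.val (ht (i p))) ⟨p.1, hi p⟩)

end MonoidalSpace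

/-! ## Čech cohomology in degree one -/

/-- A presheaf of abelian groups, written multiplicatively, on a topological space. -/
structure AbPresheaf (X : Type u) [TopologicalSpace X] where
  /-- The sections over an open set. -/
  obj : Opens X → Type v
  [grp : ∀ U, CommGroup (obj U)]
  /-- The restriction maps. -/
  res : ∀ {U V : Opens X}, V ≤ U → obj U →* obj V
  res_self : ∀ {U : Opens X} (s : obj U), res (le_refl U) s = s
  res_res : ∀ {U V W : Opens X} (h : V ≤ U) (h' : W ≤ V) (s : obj U),
    res h' (res h s) = res (h'.trans h) s

attribute [instance] AbPresheaf.grp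

namespace AbPresheaf

variable {X : Type u} [TopologicalSpace X] (F : AbPresheaf.{u, v} X) {ι : Type w}
  (U : ι → Opens X)

/-- Čech `0`-cochains. -/
abbrev C0 := ∀ i, F.obj (U i)

/-- Čech `1`-cochains. -/
abbrev C1 := ∀ i j, F.obj (U i ⊓ U j)

/-- Čech `2`-cochains. -/
abbrev C2 := ∀ i j k, F.obj (U i ⊓ U j ⊓ U k)

/-- The Čech differential `(d g)_{ij} = g_j g_i⁻¹`. -/
def d0 : F.C0 U →* F.C1 U where
  toFun g i j := F.res inf_le_right (g j) * (F.res inf_le_left (g i))⁻¹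
  map_one' := by
    funext i j
    simp
  map_mul' g h := by
    funext i j
    simp only [Pi.mul_apply, map_mul, mul_inv]
    exact mul_mul_mul_comm _ _ _ _

/-- The Čech differential `(d g)_{ijk} = g_{jk} g_{ik}⁻¹ g_{ij}`. -/
def d1 : F.C1 U →* F.C2 U where
  toFun g i j k :=
    F.res (le_inf (inf_le_left.trans inf_le_right) inf_le_right) (g j k) *
      (F.res (le_inf (inf_le_left.trans inf_le_left) inf_le_right) (g i k))⁻¹ *
      F.res inf_le_left (g i j)
  map_one' := by
    funext i j k
    simp
  map_mul' g h := by
    funext i j k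
    simp only [Pi.mul_apply, map_mul, mul_inv]
    rw [mul_mul_mul_comm (F.res _ (g j k)), mul_mul_mul_comm]

/-- `Ȟ¹(𝒰, F)`: cocycles modulo coboundaries.  (The image of `d0` is contained in the kernel
of `d1`.) -/
abbrev CechH1 :=
  (F.d1 U).ker ⧸ (F.d0 U).range.subgroupOf (F.d1 U).ker

theorem range_d0_le_ker_d1 : (F.d0 U).range ≤ (F.d1 U).ker := by
  rintro _ ⟨g, rfl⟩
  rw [MonoidHom.mem_ker]
  funext i j k
  simp only [d0, d1, MonoidHom.coe_mk, OneHom.coe_mk, F.res_res, Pi.one_apply,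
    ← div_eq_mul_inv, map_div]
  rw [div_div_div_cancel_left, div_mul_div_cancel, div_self']

/-- The product of two (pre)sheaves of abelian groups. -/
def prod (F : AbPresheaf.{u, v} X) (G : AbPresheaf.{u, w} X) : AbPresheaf.{u, max v w} X where
  obj V := F.obj V × G.obj V
  res h := (F.res h).prodMap (G.res h)
  res_self s := Prod.ext (F.res_self s.1) (G.res_self s.2)
  res_res h h' s := Prod.ext (F.res_res h h' s.1) (G.res_res h h' s.2)

/-- The constant sheaf associated with an abelian group `A`: its sections over `V` are the
locally constant functions `V → A`. -/
def const (X : Type u) [TopologicalSpace X] (A : Type v) [CommGroup A] :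
    AbPresheaf.{u, max u v} X where
  obj V := LocallyConstant V A
  res h :=
    { toFun := fun s => ⟨fun p => s ⟨p.1, h p.2⟩,
        s.isLocallyConstant.comp_continuous (continuous_inclusion h)⟩
      map_one' := rfl
      map_mul' := fun _ _ => rfl }
  res_self _ := rfl
  res_res _ _ _ := rfl

end AbPresheaf

/-- The sheaf of units `O_X^×` of a monoidal space. -/
def MonoidalSpace.units (X : MonoidalSpace.{u}) : AbPresheaf.{u, u} X.carrier where
  obj V := (X.obj V)ˣ
  res {V W} h := Units.map (X.res h : X.obj V →* X.obj W)
  res_self s := Units.ext (X.res_self s.1)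
  res_res h h' s := Units.ext (X.res_res h h' s.1)

/-- The sheaf of units `O_X^×` of a semiringed space. -/
def SemiringedSpace.units (X : SemiringedSpace.{u}) : AbPresheaf.{u, u} X.carrier where
  obj V := (X.obj V)ˣ
  res {V W} h := Units.map (X.res h : X.obj V →* X.obj W)
  res_self s := Units.ext (X.res_self s.1)
  res_res h h' s := Units.ext (X.res_res h h' s.1)

end MonSch

end

/-! Scalars and monoid units multiply to give a map `unitsComparison` from K^× × O_X^× over V to
O_{X_K}^× over V_K, compatible with restriction. If it is bijective over every finite intersection
of members of the cover, the two Čech complexes agree in the degrees that determine H^1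
(`nonempty_cechH1_equiv`).

A nonempty such intersection V is affine, hence the smallest neighbourhood of its closed point x,
and O_X(V) is the stalk at x (`germ_bijective`). Idempotency enters through one fact: a + b = 0
forces a = b = 0, so no terms cancel in K[M]. Therefore K[M] is local for nontrivial M
(`isLocalRing`), and its units are the monomials c m with c and m units (`exists_of_isUnit`).
Locality gives a point of V_K to which all points of V_K specialize, so every section over V_K is a
global fraction with invertible denominator, that is, an element of K[O_X(V)]
(`extSection_surjective`). Its units are then products c m. A locally constant function on V is
constant, so these are exactly the sections of K^× × O_X^×. -/

noncomputable section

namespace MonSch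

/-! ### Monoid semirings over an idempotent semifield -/

namespace MonSemiring

/-! ### Coefficients and monomials in K[M]. -/

section CommSemiring

variable {K : Type v} [CommSemiring K] {M : Type u} [CommMonoidWithZero M]

/-- The class in `K[M]` of a formal sum. -/
def mk : MonoidAlgebra K M →+* MonSemiring K M := (zeroCon K M).mk'

theorem mk_surjective : Function.Surjective (mk : MonoidAlgebra K M → MonSemiring K M) :=
  (zeroCon K M).mk'_surjective

/-- Two formal sums are congruent if they agree away from the absorbing element. -/
def coeffCon (K : Type v) [CommSemiring K] (M : Type u) [CommMonoidWithZero M] :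
    RingCon (MonoidAlgebra K M) where
  r f g := ∀ m : M, m ≠ 0 → f.coeff m = g.coeff m
  iseqv := ⟨fun _ _ _ => rfl, fun h m hm => (h m hm).symm,
    fun h h' m hm => (h m hm).trans (h' m hm)⟩
  add' h h' m hm := by
    rw [MonoidAlgebra.coeff_add, MonoidAlgebra.coeff_add, Finsupp.add_apply, Finsupp.add_apply,
      h m hm, h' m hm]
  mul' := by
    have key : ∀ f g h : MonoidAlgebra K M, (∀ m : M, m ≠ 0 → f.coeff m = g.coeff m) →
        ∀ m : M, m ≠ 0 → (f * h).coeff m = (g * h).coeff m := by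
      intro f g h hfg m hm
      -- The factors differ only in their terms at `0`, and `0 * d = 0` keeps the products of these
      -- terms away from the exponent `m`.
      have he : f.erase 0 = g.erase 0 := by
        ext x
        rw [MonoidAlgebra.coeff_erase, MonoidAlgebra.coeff_erase]
        by_cases hx : x = 0
        · simp [hx]
        · rw [Finsupp.erase_ne hx, Finsupp.erase_ne hx, hfg x hx]
      have hz : ∀ r : K, (MonoidAlgebra.single 0 r * h).coeff m = 0 := fun r =>
        MonoidAlgebra.coeff_single_mul_of_forall_mul_ne r h fun d => by
          rw [zero_mul]; exact hm.symm
      rw [← MonoidAlgebra.single_add_erase 0 f, ← MonoidAlgebra.single_add_erase 0 g, he,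
        add_mul, add_mul, MonoidAlgebra.coeff_add, MonoidAlgebra.coeff_add, Finsupp.add_apply,
        Finsupp.add_apply, hz, hz]
    intro f g h k hfg hhk m hm
    rw [key f g h hfg m hm, mul_comm g h, mul_comm g k, key h k g hhk m hm]

/-- This makes the coefficient at a nonzero exponent well defined on K[M]. -/
theorem zeroCon_le_coeffCon : zeroCon K M ≤ coeffCon K M := by
  refine RingCon.ringConGen_le.2 ?_
  rintro _ _ ⟨rfl, rfl⟩ m hm
  simp [hm.symm]

theorem coeff_eq_of_mk_eq {f g : MonoidAlgebra K M} (h : mk f = mk g) {m : M} (hm : m ≠ 0) :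
    f.coeff m = g.coeff m :=
  zeroCon_le_coeffCon ((RingCon.eq (zeroCon K M)).1 h) m hm

/-- The inclusion of the scalars in `K[M]`. -/
def C : K →+* MonSemiring K M := mk.comp MonoidAlgebra.singleOneRingHom

/-- The map `M → K[M]`, as a homomorphism. -/
def ofHom (K : Type v) [CommSemiring K] (M : Type u) [CommMonoidWithZero M] :
    M →* MonSemiring K M :=
  (mk : MonoidAlgebra K M →+* MonSemiring K M).toMonoidHom.comp (MonoidAlgebra.of K M)

theorem of_zero : of K (0 : M) = 0 := by
  have h : zeroCon K M (MonoidAlgebra.single 0 1) 0 := RingConGen.Rel.of _ _ ⟨rfl, rfl⟩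
  exact ((RingCon.eq (zeroCon K M)).2 h).trans (map_zero mk)

theorem mk_single (m : M) (a : K) : mk (MonoidAlgebra.single m a) = C a * of K m := by
  change _ = mk (MonoidAlgebra.single 1 a) * mk (MonoidAlgebra.single m 1)
  rw [← map_mul, MonoidAlgebra.single_mul_single, one_mul, mul_one]

/-- Formal sums that agree away from the absorbing element have the same class. -/
theorem mk_eq_of_coeff_eq {f g : MonoidAlgebra K M}
    (h : ∀ m : M, m ≠ 0 → f.coeff m = g.coeff m) : mk f = mk g := by
  have he : f.erase 0 = g.erase 0 := by
    ext x
    rw [MonoidAlgebra.coeff_erase, MonoidAlgebra.coeff_erase]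
    by_cases hx : x = 0
    · simp [hx]
    · rw [Finsupp.erase_ne hx, Finsupp.erase_ne hx, h x hx]
  rw [← MonoidAlgebra.single_add_erase 0 f, ← MonoidAlgebra.single_add_erase 0 g, he, map_add,
    map_add, mk_single, mk_single, of_zero, mul_zero, mul_zero]

theorem mk_eq_monomial {f : MonoidAlgebra K M} {m : M}
    (h : ∀ x : M, x ≠ 0 → x ≠ m → f.coeff x = 0) : mk f = C (f.coeff m) * of K m := by
  rw [← mk_single]
  refine mk_eq_of_coeff_eq fun x hx => ?_
  rw [MonoidAlgebra.coeff_single]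
  by_cases hxm : x = m
  · rw [hxm, Finsupp.single_eq_same]
  · rw [h x hx hxm, Finsupp.single_eq_of_ne hxm]

theorem monomial_inj {a b : K} {m n : M} (hm : m ≠ 0) (ha : a ≠ 0)
    (h : C a * of K m = C b * of K n) : a = b ∧ m = n := by
  rw [← mk_single, ← mk_single] at h
  have := coeff_eq_of_mk_eq h hm
  rw [MonoidAlgebra.coeff_single, MonoidAlgebra.coeff_single, Finsupp.single_eq_same] at this
  by_cases hmn : m = n
  · subst hmn
    rw [Finsupp.single_eq_same] at this
    exact ⟨this, rfl⟩
  · rw [Finsupp.single_eq_of_ne hmn] at this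
    exact absurd this ha

theorem map_mk {N : Type u} [CommMonoidWithZero N] (φ : M →*₀ N) (f : MonoidAlgebra K M) :
    map K φ (mk f) = mk (MonoidAlgebra.mapDomain φ f) := rfl

theorem map_of {N : Type u} [CommMonoidWithZero N] (φ : M →*₀ N) (m : M) :
    map K φ (of K m) = of K (φ m) := by
  change map K φ (mk (MonoidAlgebra.single m 1)) = mk (MonoidAlgebra.single (φ m) 1)
  rw [map_mk, MonoidAlgebra.mapDomain_single]

theorem map_C {N : Type u} [CommMonoidWithZero N] (φ : M →*₀ N) (a : K) :
    map K φ (C a) = C a := by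
  change map K φ (mk (MonoidAlgebra.single 1 a)) = mk (MonoidAlgebra.single 1 a)
  rw [map_mk, MonoidAlgebra.mapDomain_single, map_one]

theorem map_id (x : MonSemiring K M) : map K (MonoidWithZeroHom.id M) x = x := by
  obtain ⟨f, rfl⟩ := mk_surjective x
  rw [map_mk]
  congr 1
  induction f using MonoidAlgebra.induction_linear with
  | zero => simp
  | add a b ha hb => rw [MonoidAlgebra.mapDomain_add, ha, hb]
  | single m k => simp

theorem map_bijective {N : Type u} [CommMonoidWithZero N] (φ : M →*₀ N)
    (hφ : Function.Bijective φ) : Function.Bijective (map K φ) := by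
  let e := MulEquiv.ofBijective φ hφ
  let ψ : N →*₀ M := { e.symm.toMonoidHom with map_zero' := map_zero e.symm }
  have h₁ : ψ.comp φ = MonoidWithZeroHom.id M := by
    ext x
    exact e.symm_apply_apply x
  have h₂ : φ.comp ψ = MonoidWithZeroHom.id N := by
    ext x
    exact e.apply_symm_apply x
  refine Function.bijective_iff_has_inverse.2 ⟨map K ψ, fun x => ?_, fun x => ?_⟩
  · rw [map_map, h₁, map_id]
  · rw [map_map, h₂, map_id]

end CommSemiring

/-! ### Units and locality of K[M] for idempotent K. -/

section Idempotent

variable {K : Type v} [Semifield K] {M : Type u} [CommMonoidWithZero M]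

/-- a = a + (a + b) = (a + a) + b = a + b = 0. All uses of idempotency rest on this. -/
theorem eq_zero_of_add_eq_zero {A : Type*} [AddCommMonoid A] (hA : ∀ a : A, a + a = a) {a b : A}
    (h : a + b = 0) : a = 0 := by
  rw [← add_zero a, ← h, ← add_assoc, hA]

/-- The coefficient is a sum with the nonzero summand `f.coeff x * g.coeff y`, which nothing can
cancel. -/
theorem coeff_mul_ne_zero (hK : ∀ a : K, a + a = a) {f g : MonoidAlgebra K M} {x y : M}
    (hx : f.coeff x ≠ 0) (hy : g.coeff y ≠ 0) : (f * g).coeff (x * y) ≠ 0 := by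
  classical
  intro h
  rw [MonoidAlgebra.coeff_mul, Finsupp.sum, ← Finset.add_sum_erase _ _
    (Finsupp.mem_support_iff.2 hx)] at h
  have h' := eq_zero_of_add_eq_zero hK h
  rw [Finsupp.sum, ← Finset.add_sum_erase _ _ (Finsupp.mem_support_iff.2 hy), if_pos rfl] at h'
  exact mul_ne_zero hx hy (eq_zero_of_add_eq_zero hK h')

theorem exists_of_coeff_mul_ne_zero {f g : MonoidAlgebra K M} {z : M}
    (h : (f * g).coeff z ≠ 0) : ∃ x y, f.coeff x ≠ 0 ∧ g.coeff y ≠ 0 ∧ x * y = z := by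
  classical
  rw [MonoidAlgebra.coeff_mul] at h
  obtain ⟨x, hx, h⟩ := Finset.exists_ne_zero_of_sum_ne_zero h
  obtain ⟨y, hy, h⟩ := Finset.exists_ne_zero_of_sum_ne_zero h
  exact ⟨x, y, Finsupp.mem_support_iff.1 hx, Finsupp.mem_support_iff.1 hy,
    by_contra fun hxy => h (if_neg hxy)⟩

/-- The units of `K[M]` are the monomials with unit coefficient and unit exponent. -/
theorem exists_of_isUnit [Nontrivial M] (hK : ∀ a : K, a + a = a) {x : MonSemiring K M}
    (hx : IsUnit x) : ∃ (a : Kˣ) (m : Mˣ), x = C (a : K) * of K (m : M) := by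
  obtain ⟨y, hxy⟩ := hx.exists_right_inv
  obtain ⟨f, rfl⟩ := mk_surjective x
  obtain ⟨g, rfl⟩ := mk_surjective y
  rw [← map_mul, ← map_one mk] at hxy
  have h1 : (f * g).coeff 1 ≠ 0 := by
    rw [coeff_eq_of_mk_eq hxy one_ne_zero, MonoidAlgebra.coeff_one_one]
    exact one_ne_zero
  obtain ⟨m, n, hm, hn, hmn⟩ := exists_of_coeff_mul_ne_zero h1
  refine ⟨Units.mk0 _ hm, Units.mkOfMulEqOne m n hmn, mk_eq_monomial fun z hz hzm => ?_⟩
  -- A second exponent `z` of `f` would put `z * n` in the support of the product. It is nonzero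
  -- because `n` is a unit, so it must be `1 = m * n`, whence `z = m`.
  by_contra hfz
  have hnu : IsUnit n := (Units.mkOfMulEqOne m n hmn)⁻¹.isUnit
  have hzn : z * n ≠ 0 := fun h => hz (hnu.mul_left_eq_zero.1 h)
  have h := coeff_mul_ne_zero hK hfz hn
  rw [coeff_eq_of_mk_eq hxy hzn, MonoidAlgebra.one_def, MonoidAlgebra.coeff_single] at h
  have : z * n = 1 := by
    by_contra h'
    exact h (Finsupp.single_eq_of_ne h')
  exact hzm (hnu.mul_right_cancel (this.trans hmn.symm))

theorem isUnit_C {a : K} (ha : a ≠ 0) : IsUnit (C a : MonSemiring K M) :=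
  (IsUnit.mk0 a ha).map (C : K →+* MonSemiring K M)

theorem isUnit_of_iff [Nontrivial M] (hK : ∀ a : K, a + a = a) {m : M} :
    IsUnit (of K m) ↔ IsUnit m := by
  refine ⟨fun h => ?_, fun h => h.map (ofHom K M)⟩
  obtain ⟨a, n, h⟩ := exists_of_isUnit hK h
  obtain ⟨-, rfl⟩ := monomial_inj (b := 1) n.ne_zero a.ne_zero
    (h.symm.trans (by rw [map_one, one_mul]))
  exact n.isUnit

/-- If x + y = 1, the absence of cancellation leaves both summands no nonzero exponent other than
`1`. Both are thus scalars, and one of these is nonzero, hence invertible. -/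
theorem isLocalRing [Nontrivial M] (hK : ∀ a : K, a + a = a) :
    IsLocalRing (MonSemiring K M) := by
  have hnt : Nontrivial (MonSemiring K M) := by
    refine ⟨1, 0, fun h => ?_⟩
    rw [← map_one mk, ← map_zero mk] at h
    have := coeff_eq_of_mk_eq h (one_ne_zero : (1 : M) ≠ 0)
    simp at this
  refine { exists_pair_ne := hnt.exists_pair_ne, isUnit_or_isUnit_of_add_one := ?_ }
  intro x y hxy
  obtain ⟨f, rfl⟩ := mk_surjective x
  obtain ⟨g, rfl⟩ := mk_surjective y
  rw [← map_add, ← map_one mk] at hxy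
  have h (m : M) (hm : m ≠ 0) := coeff_eq_of_mk_eq hxy hm
  simp only [MonoidAlgebra.coeff_add, Finsupp.add_apply] at h
  have h0 (m : M) (hm : m ≠ 0) (hm1 : m ≠ 1) : f.coeff m + g.coeff m = 0 := by
    rw [h m hm, MonoidAlgebra.one_def, MonoidAlgebra.coeff_single, Finsupp.single_eq_of_ne hm1]
  by_cases hf : f.coeff 1 = 0
  · have hg : g.coeff 1 ≠ 0 := fun hg => by
      have := h 1 one_ne_zero
      rw [hf, hg, MonoidAlgebra.coeff_one_one, add_zero] at this
      exact zero_ne_one this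
    right
    rw [mk_eq_monomial fun m hm hm1 =>
      eq_zero_of_add_eq_zero hK ((add_comm _ _).trans (h0 m hm hm1))]
    exact (isUnit_C hg).mul (isUnit_one.map (ofHom K M))
  · left
    rw [mk_eq_monomial fun m hm hm1 => eq_zero_of_add_eq_zero hK (h0 m hm hm1)]
    exact (isUnit_C hf).mul (isUnit_one.map (ofHom K M))

end Idempotent

end MonSemiring

/-! ### Smallest neighbourhoods -/

/-- `V` is the smallest open neighbourhood of `x`. -/
structure IsSmallestNhd {X : Type*} [TopologicalSpace X] (V : Opens X) (x : X) : Prop where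
  mem : x ∈ V
  le_of_mem : ∀ W : Opens X, x ∈ W → V ≤ W

/-- The prime spectrum of a nontrivial monoid has a closed point, the ideal of non-units. -/
def closedPoint (M : Type u) [CommMonoidWithZero M] [Nontrivial M] : PrimeIdeal M where
  carrier := {a | ¬ IsUnit a}
  zero_mem := not_isUnit_zero
  mul_mem a b hb h := hb (isUnit_of_mul_isUnit_right h)
  one_notMem h := h isUnit_one
  mem_or_mem := by
    intro a b h
    by_contra! hab
    exact h ((not_not.1 hab.1).mul (not_not.1 hab.2))

/-- A basic open set `D(f)` contains the closed point only if `f` is a unit, and then it contains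
every prime. -/
theorem closedPoint_specializes {M : Type u} [CommMonoidWithZero M] [Nontrivial M]
    (p : PrimeIdeal M) : p ⤳ closedPoint M := by
  refine specializes_iff_forall_open.2 fun s hs => ?_
  induction hs with
  | basic s hs =>
    obtain ⟨f, rfl⟩ := hs
    intro hf hfp
    obtain ⟨g, hg⟩ := (not_not.1 hf : IsUnit f).exists_left_inv
    exact p.one_notMem (hg ▸ p.mul_mem g hfp)
  | univ => exact fun _ => trivial
  | inter s t _ _ hs ht => exact fun h => ⟨hs h.1, ht h.2⟩
  | sUnion S _ hS => exact fun ⟨s, hs, h⟩ => ⟨s, hs, hS s hs h⟩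

theorem specSections_zero_ne_one {M : Type u} [CommMonoidWithZero M] (V : Opens (PrimeIdeal M))
    (p : PrimeIdeal M) (hp : p ∈ V) : (0 : SpecSections M V) ≠ 1 := by
  intro h
  have h' : (0 : Localization p.compl) = 1 := congrFun (congrArg Subtype.val h) ⟨p, hp⟩
  rw [← Localization.mk_zero 1, ← Localization.mk_one, Localization.mk_eq_mk_iff,
    Localization.r_iff_exists] at h'
  obtain ⟨c, hc⟩ := h'
  simp only [OneMemClass.coe_one, mul_zero, mul_one] at hc
  exact c.2 (hc ▸ p.zero_mem)

namespace MonoidalSpace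

/-- A nonempty affine open subset is the smallest neighbourhood of its closed point. -/
theorem exists_isSmallestNhd (X : MonoidalSpace.{u}) (V : Opens X.carrier) {M : Type u}
    [CommMonoidWithZero M] (e : (X.restrict V).Iso (Spec M)) (hV : ∃ x, x ∈ V) :
    ∃ x, IsSmallestNhd V x ∧ Nontrivial (X.obj V) := by
  obtain ⟨y, hy⟩ := hV
  let q : PrimeIdeal M := e.homeo ⟨y, hy⟩
  have : Nontrivial M := ⟨0, 1, fun h => q.one_notMem (h ▸ q.zero_mem)⟩
  let x : V := e.homeo.symm (closedPoint M)
  refine ⟨x, ⟨x.2, fun W hW z hz => ?_⟩, ?_⟩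
  · have h : e.homeo ⟨z, hz⟩ ⤳ e.homeo x := by
      rw [show e.homeo x = closedPoint M from e.homeo.apply_symm_apply _]
      exact closedPoint_specializes _
    have h' : (⟨z, hz⟩ : V) ⤳ x := by
      have := h.map e.homeo.symm.continuous
      exact e.homeo.symm_apply_apply (⟨z, hz⟩ : V) ▸ e.homeo.symm_apply_apply x ▸ this
    exact (h'.map continuous_subtype_val).mem_open W.isOpen hW
  · have h := specSections_zero_ne_one (⊤ : Opens (PrimeIdeal M)) q trivial
    refine ⟨0, 1, fun h0 => ?_⟩
    have h1 : Subsingleton (X.obj V) := subsingleton_of_zero_eq_one h0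
    -- `e.sec ⊤` takes values over `openImage V V'`, which is `V` as a set but not by definition, so
    -- `0 = 1` is carried there by restriction.
    let V' : Opens V := Opens.comap
      (e.homeo : C((X.restrict V).carrier, (Spec M).carrier)) ⊤
    have hle : openImage V V' ≤ V := by
      rintro _ ⟨z, -, rfl⟩
      exact z.2
    have h2 : (0 : X.obj (openImage V V')) = 1 := by
      rw [← map_zero (X.res hle), ← map_one (X.res hle), h0]
    have h3 : Subsingleton (X.obj (openImage V V')) := subsingleton_of_zero_eq_one h2
    exact h ((e.sec ⊤).injective (Subsingleton.elim (α := X.obj (openImage V V')) _ _))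

variable (X : MonoidalSpace.{u}) {V : Opens X.carrier} {x : X.carrier}

theorem germ_res_apply {U V : Opens X.carrier} (h : V ≤ U) (hx : x ∈ V) (s : X.obj U) :
    X.germ V hx (X.res h s) = X.germ U (h hx) s :=
  DFunLike.congr_fun (X.germ_res h hx) s

/-- `V` is the last index of the directed system of neighbourhoods, so the colimit is its value at
`V`. -/
theorem germ_bijective (h : IsSmallestNhd V x) : Function.Bijective (X.germ V h.mem) := by
  constructor
  · intro s t hst
    obtain ⟨i, hi, hi', e⟩ := Quotient.exact hst
    have hV : V ≤ (OrderDual.ofDual i).toOpens := h.le_of_mem _ (OrderDual.ofDual i).mem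
    have e' : X.res (show (OrderDual.ofDual i).toOpens ≤ V from hi) s =
      X.res (show (OrderDual.ofDual i).toOpens ≤ V from hi') t := e
    have e'' := congrArg (X.res hV) e'
    rwa [X.res_res, X.res_res, X.res_self, X.res_self] at e''
  · intro a
    induction a using Quotient.inductionOn with | _ a => ?_
    obtain ⟨i, s⟩ := a
    have hV : V ≤ (OrderDual.ofDual i).toOpens := h.le_of_mem _ (OrderDual.ofDual i).mem
    exact ⟨X.res hV s, X.germ_res_apply hV h.mem s⟩

theorem stalk_nontrivial (h : IsSmallestNhd V x) [Nontrivial (X.obj V)] :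
    Nontrivial (X.Stalk x) :=
  (Equiv.ofBijective _ (X.germ_bijective h)).symm.nontrivial

/-- The empty family covers `V`, and every section glues it. -/
theorem subsingleton_obj_of_isEmpty (hV : ∀ x, x ∉ V) : Subsingleton (X.obj V) := by
  obtain ⟨t, -, ht⟩ := X.sheaf (ι := PEmpty) V (fun i => i.elim) (fun i => i.elim)
    (fun x hx => (hV x hx).elim) (fun i => i.elim) (fun i => i.elim)
  exact ⟨fun a b => (ht a fun i => i.elim).trans (ht b fun i => i.elim).symm⟩

/-! ### Scalar extension near a smallest neighbourhood -/

variable (K : Type v) [Semifield K]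

theorem extGerm_bijective (h : IsSmallestNhd V x) :
    Function.Bijective (X.extGerm K V h.mem) :=
  MonSemiring.map_bijective _ (X.germ_bijective h)

variable {K} in
/-- The closed point of the fibre of `X_K` over `x`. -/
def extClosedPoint (hK : ∀ a : K, a + a = a) (x : X.carrier) [Nontrivial (X.Stalk x)] :
    X.ExtPoint K :=
  haveI := MonSemiring.isLocalRing (M := X.Stalk x) hK
  { base := x
    prime := ⟨IsLocalRing.maximalIdeal (MonSemiring K (X.Stalk x)), inferInstance⟩
    contracts := fun a => by
      change _ ∈ IsLocalRing.maximalIdeal (MonSemiring K (X.Stalk x)) ↔ _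
      rw [IsLocalRing.mem_maximalIdeal, mem_nonunits_iff, MonSemiring.isUnit_of_iff hK] }

variable {K} in
theorem mem_compl_extClosedPoint (hK : ∀ a : K, a + a = a) (x : X.carrier)
    [Nontrivial (X.Stalk x)] (f : MonSemiring K (X.Stalk x)) :
    f ∈ (X.extClosedPoint hK x).compl ↔ IsUnit f := by
  have := MonSemiring.isLocalRing (M := X.Stalk x) hK
  change ¬ f ∈ IsLocalRing.maximalIdeal (MonSemiring K (X.Stalk x)) ↔ _
  rw [IsLocalRing.mem_maximalIdeal, mem_nonunits_iff, not_not]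

variable {K X} in
theorem isUnit_of_isUnit_extGerm (h : IsSmallestNhd V x) {f : MonSemiring K (X.obj V)}
    (hf : IsUnit (X.extGerm K V h.mem f)) : IsUnit f := by
  obtain ⟨g, hg⟩ := hf.exists_right_inv
  obtain ⟨g, rfl⟩ := (X.extGerm_bijective K h).2 g
  rw [← map_mul, ← map_one (X.extGerm K V h.mem)] at hg
  exact IsUnit.of_mul_eq_one g ((X.extGerm_bijective K h).1 hg)

variable {K} in
-- If a basic open set given by `f` over `U` contains the closed point, then `V ≤ U` and `f`
-- restricts to a unit over `V`; a unit avoids every prime.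
theorem extClosedPoint_specializes (hK : ∀ a : K, a + a = a) (h : IsSmallestNhd V x)
    [Nontrivial (X.Stalk x)] (z : X.ExtPoint K) (hz : z.base ∈ V) :
    z ⤳ X.extClosedPoint hK x := by
  refine specializes_iff_forall_open.2 fun s hs => ?_
  induction hs with
  | basic s hs =>
    obtain ⟨U, f, rfl⟩ := hs
    rintro ⟨hx, hf⟩
    have hVU : V ≤ U := h.le_of_mem U hx
    refine ⟨hVU hz, ?_⟩
    replace hf := (X.mem_compl_extClosedPoint hK x _).1 hf
    have hu : IsUnit (X.extRes K hVU f) := isUnit_of_isUnit_extGerm h (by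
      rw [extGerm_extRes]; exact hf)
    rw [← X.extGerm_extRes K hVU hz]
    intro hmem
    exact z.prime.2.ne_top (Ideal.eq_top_of_isUnit_mem _ hmem (hu.map _))
  | univ => exact fun _ => trivial
  | inter s t _ _ hs ht => exact fun h => ⟨hs h.1, ht h.2⟩
  | sUnion S _ hS => exact fun ⟨s, hs, h⟩ => ⟨s, hs, hS s hs h⟩

/-! ### Sections of the scalar extension -/

variable {K X} in
/-- The localization map from `K[O_{X,x}]` to the local semiring at a point over `x`. -/
abbrev ExtPoint.toLocal (z : X.ExtPoint K) :
    MonSemiring K (X.Stalk z.base) →+* Localization z.compl :=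
  algebraMap _ _

variable {K X} in
theorem ExtPoint.mk_one_eq (z : X.ExtPoint K) (a f : MonSemiring K (X.Stalk z.base))
    (hf : f ∈ z.compl) (h : f = 1) : z.toLocal a = Localization.mk a ⟨f, hf⟩ := by
  subst h
  exact (Localization.mk_one_eq_algebraMap a).symm

variable {K X} in
theorem base_mem (z : X.extOpen K V) : z.1.base ∈ V := z.2

/-- The sections of `X_K` over `V_K` given by elements of `K[O_X(V)]`. -/
def extSection (V : Opens X.carrier) :
    MonSemiring K (X.obj V) →+* X.ExtSections K (X.extOpen K V) where
  toFun b := ⟨fun z => z.1.toLocal (X.extGerm K V (base_mem z) b), fun z =>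
    ⟨V, X.extOpen K V, z.2, le_rfl, fun _ hy => hy, b, 1, fun y hy =>
      ⟨by rw [map_one]; exact y.compl.one_mem, y.mk_one_eq _ _ _ (map_one _)⟩⟩⟩
  map_one' := Subtype.ext <| funext fun z => by
    change z.1.toLocal (X.extGerm K V (base_mem z) 1) = 1
    rw [map_one, map_one]
  map_zero' := Subtype.ext <| funext fun z => by
    change z.1.toLocal (X.extGerm K V (base_mem z) 0) = 0
    rw [map_zero, map_zero]
  map_mul' a b := Subtype.ext <| funext fun z => by
    change z.1.toLocal (X.extGerm K V (base_mem z) (a * b)) =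
      z.1.toLocal (X.extGerm K V (base_mem z) a) * z.1.toLocal (X.extGerm K V (base_mem z) b)
    rw [map_mul, map_mul]
  map_add' a b := Subtype.ext <| funext fun z => by
    change z.1.toLocal (X.extGerm K V (base_mem z) (a + b)) =
      z.1.toLocal (X.extGerm K V (base_mem z) a) + z.1.toLocal (X.extGerm K V (base_mem z) b)
    rw [map_add, map_add]

/-- The sections of `X_K` over `V_K` given by locally constant families of scalars. -/
def extConst (V : Opens X.carrier) :
    LocallyConstant V Kˣ →* X.ExtSections K (X.extOpen K V) where
  toFun c := ⟨fun z => z.1.toLocal (MonSemiring.C (c ⟨z.1.base, base_mem z⟩ : K)), fun z => by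
    -- The fibre of `c` through the base point is open, and on it the family is a single scalar over
    -- the denominator `1`.
    let W : Opens X.carrier := openImage V
      ⟨_, c.isLocallyConstant.isOpen_fiber (c ⟨z.1.base, base_mem z⟩)⟩
    have hWV : W ≤ V := by
      rintro _ ⟨y, -, rfl⟩
      exact y.2
    refine ⟨V, X.extOpen K W, ⟨⟨z.1.base, base_mem z⟩, rfl, rfl⟩, fun y hy => hWV hy,
      fun y hy => hWV hy, MonSemiring.C (c ⟨z.1.base, base_mem z⟩ : K), 1, fun y hy =>
      ⟨by rw [map_one]; exact y.compl.one_mem, ?_⟩⟩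
    have hyV : y.base ∈ V := hWV hy
    have hc : c ⟨y.base, hyV⟩ = c ⟨z.1.base, base_mem z⟩ := by
      obtain ⟨t, ht, hty⟩ := hy
      rw [show (⟨y.base, hyV⟩ : V) = t from Subtype.ext hty.symm]
      exact ht
    refine Eq.trans ?_ (y.mk_one_eq (X.extGerm K V hyV (MonSemiring.C _)) _ _ (map_one _))
    change y.toLocal (MonSemiring.C (c ⟨y.base, hyV⟩ : K)) = _
    rw [hc, extGerm, MonSemiring.map_C]⟩
  map_one' := Subtype.ext <| funext fun z => by
    change z.1.toLocal (MonSemiring.C ((1 : Kˣ) : K)) = 1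
    rw [Units.val_one, map_one, map_one]
  map_mul' c d := Subtype.ext <| funext fun z => by
    change z.1.toLocal (MonSemiring.C ((c ⟨z.1.base, base_mem z⟩ * d ⟨z.1.base, base_mem z⟩ : Kˣ) : K)) =
      z.1.toLocal (MonSemiring.C (c ⟨z.1.base, base_mem z⟩ : K)) *
        z.1.toLocal (MonSemiring.C (d ⟨z.1.base, base_mem z⟩ : K))
    rw [Units.val_mul, map_mul, map_mul]

/-! ### The comparison of unit sheaves over one open set. -/

/-- The comparison map `K^× × O_X^× → O_{X_K}^×`, `(c, s) ↦ c s`, over `V`. -/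
def unitsComparison (V : Opens X.carrier) :
    LocallyConstant V Kˣ × (X.obj V)ˣ →* (X.ExtSections K (X.extOpen K V))ˣ :=
  (X.extConst K V).toHomUnits.coprod
    (Units.map ((X.extSection K V).toMonoidHom.comp (MonSemiring.ofHom K (X.obj V))))

theorem unitsComparison_apply (V : Opens X.carrier) (c : LocallyConstant V Kˣ) (s : (X.obj V)ˣ)
    (z : X.extOpen K V) :
    (X.unitsComparison K V (c, s)).val.1 z = z.1.toLocal (MonSemiring.C
      (c ⟨z.1.base, base_mem z⟩ : K) * MonSemiring.of K (X.germ V (base_mem z) (s : X.obj V))) := by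
  rw [map_mul, ← MonSemiring.map_of]
  rfl

/-- Empty intersections are allowed, being the spectrum of the zero monoid; there both groups are
trivial. -/
theorem unitsComparison_bijective_of_isEmpty (hV : ∀ x, x ∉ V) :
    Function.Bijective (X.unitsComparison K V) := by
  have : IsEmpty V := ⟨fun x => hV x.1 x.2⟩
  have := X.subsingleton_obj_of_isEmpty hV
  constructor
  · rintro ⟨c, s⟩ ⟨d, t⟩ -
    exact Prod.ext (LocallyConstant.ext fun y => isEmptyElim y)
      (Units.ext (Subsingleton.elim _ _))
  · intro t
    exact ⟨1, Units.ext (Subtype.ext (funext fun z => (hV _ z.2).elim))⟩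

variable {K X} in
theorem toLocal_injective_of_isUnit (z : X.ExtPoint K) (hz : ∀ f ∈ z.compl, IsUnit f) :
    Function.Injective z.toLocal := by
  intro a b hab
  rw [ExtPoint.toLocal, ← Localization.mk_one_eq_algebraMap, ← Localization.mk_one_eq_algebraMap,
    Localization.mk_eq_mk_iff, Localization.r_iff_exists] at hab
  obtain ⟨c, hc⟩ := hab
  simpa using (hz c c.2).mul_left_cancel hc

variable {K X} in
-- A fraction `a / f` representing `t` near the closed point represents it on all of V_K, since
-- every neighbourhood of that point contains V_K. Moreover `f` is a unit over `V`, because it lies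
-- outside the maximal ideal.
theorem extSection_surjective (hK : ∀ a : K, a + a = a) (h : IsSmallestNhd V x)
    [Nontrivial (X.Stalk x)] : Function.Surjective (X.extSection K V) := by
  intro t
  obtain ⟨U, W, hzW, hWV, hWU, a, f, e⟩ := t.2 ⟨X.extClosedPoint hK x, h.mem⟩
  have hW (z : X.ExtPoint K) (hz : z.base ∈ V) : z ∈ W :=
    (X.extClosedPoint_specializes hK h z hz).mem_open W.isOpen hzW
  have hVU : V ≤ U := h.le_of_mem U (hWU _ hzW)
  obtain ⟨hf, -⟩ := e _ hzW
  have hu : IsUnit (X.extRes K hVU f) := isUnit_of_isUnit_extGerm h (by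
    rw [extGerm_extRes]; exact (X.mem_compl_extClosedPoint hK x _).1 hf)
  obtain ⟨g, hg⟩ := hu.exists_right_inv
  refine ⟨X.extRes K hVU a * g, Subtype.ext (funext fun z => ?_)⟩
  obtain ⟨hfz, ez⟩ := e z.1 (hW z.1 (base_mem z))
  refine Eq.trans ?_ ez.symm
  change z.1.toLocal (X.extGerm K V (base_mem z) (X.extRes K hVU a * g)) = _
  have hg' : X.extGerm K U (hVU (base_mem z)) f * X.extGerm K V (base_mem z) g = 1 := by
    rw [← X.extGerm_extRes K hVU (base_mem z) f, ← map_mul, hg, map_one]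
  rw [map_mul, X.extGerm_extRes K hVU (base_mem z) a, ExtPoint.toLocal,
    ← Localization.mk_one_eq_algebraMap, Localization.mk_eq_mk_iff, Localization.r_iff_exists]
  refine ⟨1, ?_⟩
  rw [OneMemClass.coe_one, one_mul, one_mul, one_mul, mul_left_comm, hg', mul_one]

variable {K X} in
-- Everything is read off at the closed point `z`, whose local semiring contains K[O_{X,x}] because
-- only units are inverted there.
theorem unitsComparison_bijective (hK : ∀ a : K, a + a = a) (h : IsSmallestNhd V x)
    [Nontrivial (X.obj V)] : Function.Bijective (X.unitsComparison K V) := by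
  have hx := X.stalk_nontrivial h
  let z : X.extOpen K V := ⟨X.extClosedPoint hK x, h.mem⟩
  have hinj : Function.Injective z.1.toLocal := toLocal_injective_of_isUnit z.1 fun f hf =>
    (X.mem_compl_extClosedPoint hK x f).1 hf
  constructor
  · rintro ⟨c, s⟩ ⟨d, t⟩ hst
    have e := congrArg (fun r => r.val.1 z) hst
    simp only [unitsComparison_apply] at e
    obtain ⟨hcd, hst⟩ := MonSemiring.monomial_inj (K := K)
      ((s.isUnit.map (X.germ V h.mem)).ne_zero) (Units.ne_zero _) (hinj e)
    refine Prod.ext (LocallyConstant.ext fun y => ?_) (Units.ext ((X.germ_bijective h).1 hst))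
    -- The fibre of `c` through `x` is an open neighbourhood of `x`, hence contains `V`.
    have hy (c : LocallyConstant V Kˣ) : c y = c ⟨x, h.mem⟩ := by
      let W := openImage V ⟨_, c.isLocallyConstant.isOpen_fiber (c ⟨x, h.mem⟩)⟩
      obtain ⟨y', hy', e'⟩ := h.le_of_mem W ⟨⟨x, h.mem⟩, rfl, rfl⟩ y.2
      rw [← Subtype.ext e']
      exact hy'
    exact (hy c).trans ((Units.ext hcd : c ⟨x, h.mem⟩ = d ⟨x, h.mem⟩).trans (hy d).symm)
  · intro t
    obtain ⟨b, hb⟩ := extSection_surjective hK h t.val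
    obtain ⟨b', hb'⟩ := extSection_surjective hK h t.inv
    -- The lifts of `t` and of its inverse are inverse to each other already in K[O_{X,x}], by
    -- injectivity at `z`; so the germ of `b` is a monomial.
    have hbb : X.extGerm K V h.mem (b * b') = 1 := by
      have e : X.extSection K V (b * b') = 1 := by
        rw [map_mul, hb, hb', t.val_inv]
      refine hinj ((congrFun (congrArg Subtype.val e) z).trans ?_)
      exact (map_one z.1.toLocal).symm
    rw [map_mul] at hbb
    obtain ⟨a, m, ham⟩ := MonSemiring.exists_of_isUnit hK (IsUnit.of_mul_eq_one _ hbb)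
    let e := MulEquiv.ofBijective (X.germ V h.mem) (X.germ_bijective h)
    let s : (X.obj V)ˣ := Units.map e.symm.toMonoidHom m
    have hs : X.germ V h.mem (s : X.obj V) = m := e.apply_symm_apply (m : X.Stalk x)
    have hbs : b = MonSemiring.C (a : K) * MonSemiring.of K (s : X.obj V) := by
      refine (X.extGerm_bijective K h).1 ?_
      rw [ham, map_mul, extGerm, MonSemiring.map_C, MonSemiring.map_of, hs]
    refine ⟨(LocallyConstant.const V a, s), Units.ext (hb ▸ ?_)⟩
    refine Subtype.ext (funext fun y => (X.unitsComparison_apply K V _ _ y).trans ?_)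
    change _ = y.1.toLocal (X.extGerm K V (base_mem y) b)
    rw [hbs, map_mul (X.extGerm K V (base_mem y)), extGerm, MonSemiring.map_C, MonSemiring.map_of]
    rfl

end MonoidalSpace

/-! ### Comparison of Čech cohomology groups -/

namespace AbPresheaf

/-- A morphism of presheaves over a continuous map that is bijective on the members of a cover
and on their double intersections, and injective on the triple intersections, induces an
isomorphism on Čech cohomology in degree one. -/
theorem nonempty_cechH1_equiv {X : Type*} {Y : Type*} [TopologicalSpace X] [TopologicalSpace Y]
    (F : AbPresheaf X) (G : AbPresheaf Y) (f : C(Y, X))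
    (φ : ∀ V : Opens X, F.obj V →* G.obj (Opens.comap f V))
    (hφ : ∀ {V W : Opens X} (h : W ≤ V) (s : F.obj V),
      φ W (F.res h s) = G.res (Opens.comap_mono f h) (φ V s))
    {ι : Type*} (U : ι → Opens X) (h0 : ∀ i, Function.Bijective (φ (U i)))
    (h1 : ∀ i j, Function.Bijective (φ (U i ⊓ U j)))
    (h2 : ∀ i j k, Function.Injective (φ (U i ⊓ U j ⊓ U k))) :
    Nonempty (G.CechH1 (fun i => Opens.comap f (U i)) ≃* F.CechH1 U) := by
  let U' : ι → Opens Y := fun i => Opens.comap f (U i)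
  let e1 : F.C1 U ≃* G.C1 U' :=
    MulEquiv.piCongrRight fun i => MulEquiv.piCongrRight fun j =>
      MulEquiv.ofBijective (φ (U i ⊓ U j)) (h1 i j)
  have hd0 (g : F.C0 U) : e1 (F.d0 U g) = G.d0 U' fun i => φ (U i) (g i) := by
    funext i j
    change φ (U i ⊓ U j) (F.res inf_le_right (g j) * (F.res inf_le_left (g i))⁻¹) = _
    rw [map_mul, map_inv, hφ, hφ]
    rfl
  have hd1 (g : F.C1 U) (i j k : ι) : φ (U i ⊓ U j ⊓ U k) (F.d1 U g i j k) =
      G.d1 U' (e1 g) i j k := by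
    change φ (U i ⊓ U j ⊓ U k) (F.res _ (g j k) * (F.res _ (g i k))⁻¹ * F.res _ (g i j)) = _
    rw [map_mul, map_mul, map_inv, hφ, hφ, hφ]
    rfl
  have hker : (F.d1 U).ker.map (e1 : F.C1 U →* G.C1 U') = (G.d1 U').ker := by
    refine Subgroup.ext fun g' => ⟨?_, fun hg' => ⟨e1.symm g', ?_, e1.apply_symm_apply g'⟩⟩
    · rintro ⟨g, hg, rfl⟩
      refine MonoidHom.mem_ker.2 (funext fun i => funext fun j => funext fun k => ?_)
      refine (hd1 g i j k).symm.trans ?_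
      rw [MonoidHom.mem_ker.1 hg]
      exact map_one _
    -- Injectivity on triple intersections lets the cocycle condition descend from `G` to `F`.
    · refine MonoidHom.mem_ker.2 (funext fun i => funext fun j => funext fun k => h2 i j k ?_)
      rw [hd1, e1.apply_symm_apply, MonoidHom.mem_ker.1 hg']
      exact (map_one (φ (U i ⊓ U j ⊓ U k))).symm
  let e : (F.d1 U).ker ≃* (G.d1 U').ker :=
    (e1.subgroupMap _).trans (MulEquiv.subgroupCongr hker)
  have he (g : (F.d1 U).ker) : (e g : G.C1 U') = e1 g := rfl
  refine ⟨(QuotientGroup.congr _ _ e (Subgroup.ext fun g' => ⟨?_, ?_⟩)).symm⟩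
  · rintro ⟨g, ⟨c, hc⟩, rfl⟩
    exact ⟨fun i => φ (U i) (c i), (hd0 c).symm.trans (congrArg e1 hc)⟩
  · rintro ⟨c', hc'⟩
    -- Surjectivity on the members of the cover lifts the cochain that trivializes the cocycle.
    choose c hc using fun i => (h0 i).2 (c' i)
    obtain rfl : (fun i => φ (U i) (c i)) = c' := funext hc
    refine ⟨⟨F.d0 U c, F.range_d0_le_ker_d1 U ⟨c, rfl⟩⟩, ⟨c, rfl⟩, Subtype.ext ?_⟩
    exact (he _).trans ((hd0 c).trans hc')

end AbPresheaf

/-! ### Application to the given cover. -/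

namespace MonoidScheme

theorem IsCancellativeCover.unitsComparison_bijective {X : MonoidScheme.{u}} {ι : Type w}
    {U : ι → Opens X.carrier} (hU : X.IsCancellativeCover U) {K : Type v} [Semifield K]
    (hK : ∀ a : K, a + a = a) (s : Finset ι) (hs : s.Nonempty) :
    Function.Bijective (X.unitsComparison K (s.inf U)) := by
  obtain ⟨M, _, -, ⟨e⟩⟩ := hU.inter s hs
  by_cases hV : ∃ x, x ∈ s.inf U
  · obtain ⟨x, hx, _⟩ := X.exists_isSmallestNhd _ e hV
    exact MonoidalSpace.unitsComparison_bijective hK hx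
  · exact X.unitsComparison_bijective_of_isEmpty K (not_exists.1 hV)

end MonoidScheme

end MonSch
end

theorem theorem3p5 (X : MonSch.MonoidScheme.{u}) [IrreducibleSpace X.carrier]
    {ι : Type w} (U : ι → TopologicalSpace.Opens X.carrier) (hU : X.IsCancellativeCover U)
    (K : Type v) [Semifield K] (hK : ∀ a : K, a + a = a) :
    Nonempty
      ((X.scalarExt K).units.CechH1 (fun i => X.extOpen K (U i)) ≃*
        ((MonSch.AbPresheaf.const X.carrier Kˣ).prod X.units).CechH1 U) := by
  classical
  refine MonSch.AbPresheaf.nonempty_cechH1_equiv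
    ((MonSch.AbPresheaf.const X.carrier Kˣ).prod X.units) (X.scalarExt K).units (X.extProj K)
    (fun V => X.unitsComparison K V) ?_ U ?_ ?_ ?_
  -- Naturality: at each point both sides are the same scalar times the same germ.
  · rintro V W h ⟨c, s⟩
    refine Units.ext (Subtype.ext (funext fun z => ?_))
    refine (X.unitsComparison_apply K W _ _ z).trans
      (Eq.trans ?_ (X.unitsComparison_apply K V c s ⟨z.1, h z.2⟩).symm)
    have hz : z.1.base ∈ W := z.2
    exact congrArg (fun m => z.1.toLocal (MonSch.MonSemiring.C
      (c.toFun ⟨z.1.base, h hz⟩ : K) * MonSch.MonSemiring.of K m))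
      (X.germ_res_apply h hz (s.val : X.obj V))
  · intro i
    have := hU.unitsComparison_bijective hK {i} (Finset.singleton_nonempty i)
    rwa [Finset.inf_singleton] at this
  · intro i j
    -- The indices may coincide; the infimum over the finite set is `U i ⊓ U j` in any case.
    have := hU.unitsComparison_bijective hK {i, j} (Finset.insert_nonempty _ _)
    rwa [Finset.inf_insert, Finset.inf_singleton] at this
  · intro i j k
    have := hU.unitsComparison_bijective hK {i, j, k} (Finset.insert_nonempty _ _)
    rw [Finset.inf_insert, Finset.inf_insert, Finset.inf_singleton, ← inf_assoc] at this
    exact this.1
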